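/- Let $M$ be a metric space with metric $d$ and a fixed base point $0\in M$. Let $\mathrm{Lip}_0(M)$ be the real normed space of all Lipschitz functions $f\colon M\to\mathbb R$ with $f(0)=0$, with the norm $\|f\|=\sup\{|f(x)-f(y)|/d(x,y)\colon x,y\in M,\ x\ne y\}$. Put $\widetilde M=\{(x,y)\colon x,y\in M,\ x\neq y\}$, and let $\Phi\colon\mathrm{Lip}_0(M)\to\ell_\infty(\widetilde M)$ be the linear isometry $(\Phi f)(x,y)=\frac{f(x)-f(y)}{d(x,y)}$. Let $ba(\widetilde M)$ be the space of bounded finitely additive signed measures on the power set of $\widetilde M$, with the total variation norm $\|\mu\|=|\mu|(\widetilde M)$. For $\mu\in ba(\widetilde M)$ let $\Phi^*\mu\in\mathrm{Lip}_0(M)^*$ be the functional $(\Phi^*\mu)(f)=\int_{\widetilde M}\Phi f\,d\mu$. Call $\mu$ optimal if $\mu\ge 0$ and $\|\Phi^*\mu\|=\|\mu\|$. For $\gamma\in(0,1]$, a set $A\subseteq\widetilde M$ is called $\gamma$-cyclically monotonic if for every finite sequence $(x_1,y_1),\dots,(x_n,y_n)\in A$, with $y_{n+1}=y_1$, $$\sum_{i=1}^n\min\bigl\{d(x_i,y_{i+1})-\gamma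 d(x_i,y_i),\ d(y_i,y_{i+1})\bigr\}\ge 0.$$ A real normed space $X$ with closed unit ball $B_X$ has the local diameter $2$ property (LD2P) if for all $x^*\in X^*$ with $\|x^*\|=1$ and all $\alpha>0$, the slice $\{x\in B_X\colon x^*(x)>1-\alpha\}$ has diameter $2$. Then $\mathrm{Lip}_0(M)$ has the LD2P if and only if for every optimal $\mu\in ba(\widetilde M)$ with $\|\mu\|=1$ and every $\gamma\in(0,1)$, there exist a subset $A$ of $\widetilde M$ and $u,v\in M$ with $u\neq v$ such that $\mu(A)\ge\gamma$ and the sets $A\cup\{(u,v)\}$ and $A\cup\{(v,u)\}$ are both $\gamma$-cyclically monotonic. -/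

import Mathlib

noncomputable section

namespace LipSpace

open MeasureTheory
open scoped ENNReal NNReal

/-! ### Pairs of distinct points and the space of Lipschitz functions vanishing at the base point -/

/-- The set `{(x, y) : x, y ∈ M, x ≠ y}`. -/
abbrev Pairs (M : Type*) : Type _ := {p : M × M // p.1 ≠ p.2}

/-- The de Leeuw transform `(x, y) ↦ (f x - f y) / d(x, y)`, on all functions `f : M → ℝ`. -/
def slope {M : Type*} [MetricSpace M] (f : M → ℝ) (p : Pairs M) : ℝ :=
  (f p.1.1 - f p.1.2) / dist p.1.1 p.1.2

/-- The vector space of the Lipschitz functions `f : M → ℝ` with `f o = 0`. -/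
def lipSubmodule {M : Type*} [MetricSpace M] (o : M) : Submodule ℝ (M → ℝ) where
  carrier := {f | (∃ K : ℝ≥0, LipschitzWith K f) ∧ f o = 0}
  zero_mem' := ⟨⟨0, LipschitzWith.const 0⟩, rfl⟩
  add_mem' := by
    rintro f g ⟨⟨K, hK⟩, hf⟩ ⟨⟨L, hL⟩, hg⟩
    exact ⟨⟨K + L, hK.add hL⟩, by simp [hf, hg]⟩
  smul_mem' := by
    rintro c f ⟨⟨K, hK⟩, hf⟩
    refine ⟨⟨‖c‖₊ * K, ?_⟩, by simp [hf]⟩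
    exact (lipschitzWith_smul c).comp hK

/-- `Lip₀(M)`, for `M` pointed by `o`. It is a type of its own (and not reducible to the
submodule), so that it carries the Lipschitz norm and not the topology of pointwise convergence. -/
def Lip0 {M : Type*} [MetricSpace M] (o : M) : Type _ := lipSubmodule o

namespace Lip0

variable {M : Type*} [MetricSpace M] {o : M}

instance : AddCommGroup (Lip0 o) := inferInstanceAs (AddCommGroup (lipSubmodule o))

instance : Module ℝ (Lip0 o) := inferInstanceAs (Module ℝ (lipSubmodule o))

instance : CoeFun (Lip0 o) (fun _ => M → ℝ) := ⟨fun f => f.1⟩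

theorem add_apply (f g : Lip0 o) (x : M) : (f + g) x = f x + g x := rfl

theorem smul_apply (c : ℝ) (f : Lip0 o) (x : M) : (c • f) x = c * f x := rfl

theorem zero_apply (x : M) : (0 : Lip0 o) x = 0 := rfl

/-- The Lipschitz norm `sup {|f x - f y| / d(x, y) : x ≠ y}`. -/
instance : Norm (Lip0 o) := ⟨fun f => ⨆ p : Pairs M, |f p.1.1 - f p.1.2| / dist p.1.1 p.1.2⟩

theorem norm_def (f : Lip0 o) :
    ‖f‖ = ⨆ p : Pairs M, |f p.1.1 - f p.1.2| / dist p.1.1 p.1.2 := rfl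

theorem norm_slope (f : M → ℝ) (p : Pairs M) :
    ‖slope f p‖ = |f p.1.1 - f p.1.2| / dist p.1.1 p.1.2 := by
  rw [slope, Real.norm_eq_abs, abs_div, abs_of_nonneg dist_nonneg]

theorem memℓp_slope (f : Lip0 o) : Memℓp (E := fun _ : Pairs M => ℝ) (slope f) ∞ := by
  obtain ⟨K, hK⟩ := f.2.1
  refine memℓp_infty ⟨K, ?_⟩
  rintro _ ⟨p, rfl⟩
  dsimp only
  rw [norm_slope, div_le_iff₀ (dist_pos.2 p.2)]
  have := hK.dist_le_mul p.1.1 p.1.2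
  rwa [Real.dist_eq] at this

/-- The de Leeuw transform as a linear map into `ℓ_∞`. -/
def slopeLin (o : M) : Lip0 o →ₗ[ℝ] lp (fun _ : Pairs M => ℝ) ∞ where
  toFun f := ⟨slope f, memℓp_slope f⟩
  map_add' f g := by
    ext p
    change slope _ p = slope _ p + slope _ p
    simp only [slope, add_apply]
    ring
  map_smul' c f := by
    ext p
    change slope _ p = c * slope _ p
    simp only [slope, smul_apply]
    ring

theorem norm_slopeLin (f : Lip0 o) : ‖slopeLin o f‖ = ‖f‖ := by
  rw [lp.norm_eq_ciSup, norm_def]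
  exact iSup_congr fun p => norm_slope f p

theorem slopeLin_injective : Function.Injective (slopeLin o) := by
  rw [injective_iff_map_eq_zero]
  intro f hf
  refine Subtype.ext (funext fun x => ?_)
  change f x = 0
  by_cases hx : x = o
  · rw [hx]; exact f.2.2
  · have h1 : slope f ⟨(x, o), hx⟩ = 0 := congrFun (congrArg Subtype.val hf) ⟨(x, o), hx⟩
    have h2 : f o = 0 := f.2.2
    have h3 : dist x o ≠ 0 := dist_ne_zero.2 hx
    simpa [slope, h2, h3] using h1

theorem normCore (o : M) : NormedSpace.Core ℝ (Lip0 o) where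
  norm_nonneg f := by rw [← norm_slopeLin]; exact norm_nonneg _
  norm_smul c f := by rw [← norm_slopeLin, map_smul, norm_smul, norm_slopeLin]
  norm_triangle f g := by
    rw [← norm_slopeLin, map_add, ← norm_slopeLin f, ← norm_slopeLin g]
    exact norm_add_le _ _
  norm_eq_zero_iff f := by
    rw [← norm_slopeLin, norm_eq_zero]
    exact ⟨fun h => slopeLin_injective (h.trans (map_zero _).symm), fun h => by rw [h, map_zero]⟩

instance : NormedAddCommGroup (Lip0 o) := NormedAddCommGroup.ofCore (normCore o)

instance : NormedSpace ℝ (Lip0 o) := NormedSpace.ofCore (normCore o)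

end Lip0

/-- De Leeuw's map `Φ : Lip₀(M) → ℓ_∞`, `Φ f (x, y) = (f x - f y) / d(x, y)`: a linear isometry. -/
def deLeeuw {M : Type*} [MetricSpace M] (o : M) : Lip0 o →ₗᵢ[ℝ] lp (fun _ : Pairs M => ℝ) ∞ where
  toLinearMap := Lip0.slopeLin o
  norm_map' := Lip0.norm_slopeLin

theorem deLeeuw_apply {M : Type*} [MetricSpace M] (o : M) (f : Lip0 o) (p : Pairs M) :
    deLeeuw o f p = (f p.1.1 - f p.1.2) / dist p.1.1 p.1.2 := rfl

/-! ### Bounded finitely additive signed measures -/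

/-- `ba(α)`: the bounded finitely additive signed measures on the power set of `α`. -/
structure BA (α : Type*) where
  toFun : Set α → ℝ
  union' : ∀ A B : Set α, Disjoint A B → toFun (A ∪ B) = toFun A + toFun B
  bounded' : ∃ C : ℝ, ∀ A : Set α, |toFun A| ≤ C

namespace BA

variable {α : Type*}

instance : CoeFun (BA α) (fun _ => Set α → ℝ) := ⟨BA.toFun⟩

/-- The norm of `μ ∈ ba(α)` is its total variation `|μ|(α)`, the supremum of the sums
`∑ |μ(A_i)|` over the finite families of pairwise disjoint subsets of `α`. -/
instance : Norm (BA α) :=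
  ⟨fun μ => sSup {t : ℝ | ∃ P : Finset (Set α), (P : Set (Set α)).PairwiseDisjoint id ∧
    t = ∑ A ∈ P, |μ A|}⟩

theorem norm_def (μ : BA α) :
    ‖μ‖ = sSup {t : ℝ | ∃ P : Finset (Set α), (P : Set (Set α)).PairwiseDisjoint id ∧
      t = ∑ A ∈ P, |μ A|} := rfl

theorem empty (μ : BA α) : μ ∅ = 0 := by
  have := μ.union' ∅ ∅ (by simp)
  simp only [Set.union_self] at this
  linarith

theorem sum_eq (μ : BA α) (P : Finset (Set α)) (hP : (P : Set (Set α)).PairwiseDisjoint id) :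
    ∑ A ∈ P, μ A = μ (⋃ A ∈ P, A) := by
  classical
  induction P using Finset.induction_on with
  | empty => simp [μ.empty]
  | insert A P hA ih =>
    rw [Finset.sum_insert hA, ih (hP.subset (by simp)), Finset.set_biUnion_insert, μ.union']
    rw [Set.disjoint_iUnion₂_right]
    intro B hB
    exact hP (by simp) (by simp [hB]) (fun h => hA (h ▸ hB))

/-- The supremum in the definition of the norm is that of a bounded set. -/
theorem bddAbove_norm (μ : BA α) :
    BddAbove {t : ℝ | ∃ P : Finset (Set α), (P : Set (Set α)).PairwiseDisjoint id ∧
      t = ∑ A ∈ P, |μ A|} := by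
  classical
  obtain ⟨C, hC⟩ := μ.bounded'
  refine ⟨C + C, ?_⟩
  rintro _ ⟨P, hP, rfl⟩
  rw [← Finset.sum_filter_add_sum_filter_not P (fun A => 0 ≤ μ A)]
  have h1 : ∑ A ∈ P with 0 ≤ μ A, |μ A| = ∑ A ∈ P with 0 ≤ μ A, μ A :=
    Finset.sum_congr rfl fun A hA => abs_of_nonneg (Finset.mem_filter.1 hA).2
  have h2 : ∑ A ∈ P with ¬ 0 ≤ μ A, |μ A| = -∑ A ∈ P with ¬ 0 ≤ μ A, μ A := by
    rw [← Finset.sum_neg_distrib]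
    exact Finset.sum_congr rfl fun A hA =>
      abs_of_neg (not_le.1 (Finset.mem_filter.1 hA).2)
  rw [h1, h2, μ.sum_eq _ (hP.subset fun A hA => (Finset.mem_filter.1 hA).1),
    μ.sum_eq _ (hP.subset fun A hA => (Finset.mem_filter.1 hA).1)]
  exact add_le_add ((le_abs_self _).trans (hC _)) ((neg_le_abs _).trans (hC _))

theorem sum_le_norm (μ : BA α) (P : Finset (Set α))
    (hP : (P : Set (Set α)).PairwiseDisjoint id) : ∑ A ∈ P, |μ A| ≤ ‖μ‖ :=
  le_csSup μ.bddAbove_norm ⟨P, hP, rfl⟩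

/-- The indicator function of `A`, as an element of `ℓ_∞(α)`. -/
def ind (A : Set α) : lp (fun _ : α => ℝ) ∞ :=
  ⟨A.indicator 1, memℓp_infty ⟨1, by
    rintro _ ⟨x, rfl⟩
    by_cases hx : x ∈ A <;> simp [hx]⟩⟩

theorem ind_apply (A : Set α) (x : α) : ind A x = A.indicator (fun _ => (1 : ℝ)) x := rfl

/-- The bounded functions with finite range. -/
def simple (α : Type*) : Submodule ℝ (lp (fun _ : α => ℝ) ∞) where
  carrier := {f | (Set.range f).Finite}
  zero_mem' := (Set.finite_singleton (0 : ℝ)).subset (by rintro _ ⟨x, rfl⟩; rfl)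
  add_mem' := by
    intro f g hf hg
    refine (hf.image2 (· + ·) hg).subset ?_
    rintro _ ⟨x, rfl⟩
    exact ⟨f x, ⟨x, rfl⟩, g x, ⟨x, rfl⟩, rfl⟩
  smul_mem' := by
    intro c f hf
    refine (hf.image (c * ·)).subset ?_
    rintro _ ⟨x, rfl⟩
    exact ⟨f x, ⟨x, rfl⟩, rfl⟩

/-- A function with finite range as a simple function for the power set of `α`. -/
def toSF (f : simple α) : @SimpleFunc α ⊤ ℝ :=
  @SimpleFunc.mk α ⊤ ℝ (fun x => f.1 x) (fun _ => trivial) f.2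

/-- The vector-valued set function through which the elementary integral is formed. -/
def T (μ : BA α) (A : Set α) : ℝ →L[ℝ] ℝ := μ A • ContinuousLinearMap.id ℝ ℝ

theorem T_add (μ : BA α) : @FinMeasAdditive α _ _ ⊤ 0 μ.T := by
  intro s t _ _ _ _ hst
  simp only [T, μ.union' s t hst, add_smul]

/-- The elementary integral `∑_r r μ(f = r)` of a function with finite range. -/
def simpleInt (μ : BA α) : simple α →ₗ[ℝ] ℝ where
  toFun f := @SimpleFunc.setToSimpleFunc α ℝ ℝ _ _ _ _ ⊤ μ.T (toSF f)
  map_add' f g := by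
    let _ : MeasurableSpace α := ⊤
    have h : toSF (f + g) = toSF f + toSF g := SimpleFunc.ext fun _ => rfl
    rw [h]
    exact SimpleFunc.setToSimpleFunc_add (μ := (0 : Measure α)) μ.T μ.T_add (f := toSF f)
      (g := toSF g) integrable_zero_measure integrable_zero_measure
  map_smul' c f := by
    let _ : MeasurableSpace α := ⊤
    have h : toSF (c • f) = c • toSF f := SimpleFunc.ext fun _ => rfl
    rw [h]
    exact SimpleFunc.setToSimpleFunc_smul_real (μ := (0 : Measure α)) μ.T μ.T_add c (f := toSF f)
      integrable_zero_measure

theorem simpleInt_apply (μ : BA α) (f : simple α) :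
    μ.simpleInt f = ∑ r ∈ f.2.toFinset, r * μ {x | f.1 x = r} := by
  have h : @SimpleFunc.range α ℝ ⊤ (toSF f) = f.2.toFinset := by
    ext r
    exact (@SimpleFunc.mem_range α ℝ ⊤ (toSF f) r).trans f.2.mem_toFinset.symm
  change ∑ r ∈ @SimpleFunc.range α ℝ ⊤ (toSF f), _ = _
  rw [h]
  exact Finset.sum_congr rfl fun r _ => mul_comm _ _

theorem abs_simpleInt_le (μ : BA α) (f : simple α) : |μ.simpleInt f| ≤ ‖μ‖ * ‖f‖ := by
  classical
  rw [simpleInt_apply]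
  have hinj : Set.InjOn (fun r : ℝ => {x | f.1 x = r}) (f.2.toFinset : Set ℝ) := by
    intro r hr s _ h
    obtain ⟨x, hx⟩ := f.2.mem_toFinset.1 hr
    have : x ∈ {x | f.1 x = s} := by
      rw [← show {x | f.1 x = r} = {x | f.1 x = s} from h]; exact hx
    exact hx.symm.trans this
  have hle : ∑ r ∈ f.2.toFinset, |μ {x | f.1 x = r}| ≤ ‖μ‖ := by
    rw [← Finset.sum_image (f := fun A : Set α => |μ A|) hinj]
    refine μ.sum_le_norm _ ?_
    intro A hA B hB hAB
    simp only [Finset.coe_image, Set.mem_image] at hA hB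
    obtain ⟨r, _, rfl⟩ := hA
    obtain ⟨s, _, rfl⟩ := hB
    refine Set.disjoint_left.2 fun x hx hx' => hAB ?_
    have : r = s := (show f.1 x = r from hx).symm.trans hx'
    rw [this]
  calc |∑ r ∈ f.2.toFinset, r * μ {x | f.1 x = r}|
      ≤ ∑ r ∈ f.2.toFinset, ‖f‖ * |μ {x | f.1 x = r}| := by
        refine (Finset.abs_sum_le_sum_abs _ _).trans (Finset.sum_le_sum fun r hr => ?_)
        obtain ⟨x, hx⟩ := f.2.mem_toFinset.1 hr
        rw [abs_mul]
        refine mul_le_mul_of_nonneg_right ?_ (abs_nonneg _)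
        rw [← hx]
        exact lp.norm_apply_le_norm ENNReal.top_ne_zero f.1 x
    _ = ‖f‖ * ∑ r ∈ f.2.toFinset, |μ {x | f.1 x = r}| := by rw [Finset.mul_sum]
    _ ≤ ‖f‖ * ‖μ‖ := mul_le_mul_of_nonneg_left hle (norm_nonneg _)
    _ = ‖μ‖ * ‖f‖ := mul_comm _ _

theorem ind_mem_simple (A : Set α) : ind A ∈ simple α := by
  refine (Set.toFinite ({0, 1} : Set ℝ)).subset ?_
  rintro _ ⟨x, rfl⟩
  by_cases hx : x ∈ A <;> simp [ind_apply, hx]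

theorem simpleInt_ind (μ : BA α) (A : Set α) : μ.simpleInt ⟨ind A, ind_mem_simple A⟩ = μ A := by
  classical
  rw [simpleInt_apply]
  have hA : {x | ind A x = 1} = A := by
    ext x; by_cases hx : x ∈ A <;> simp [ind_apply, hx]
  rw [Finset.sum_eq_single (1 : ℝ)]
  · simp only [hA, one_mul]
  · intro r hr h1
    obtain ⟨x, hx⟩ := (ind_mem_simple A).mem_toFinset.1 hr
    have : r = 0 := by
      rw [← hx] at h1 ⊢
      by_cases hxA : x ∈ A
      · exact absurd (by simp [ind_apply, hxA]) h1
      · simp [ind_apply, hxA]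
    rw [this, zero_mul]
  · intro h
    have : {x | ind A x = 1} = ∅ := by
      ext x
      simp only [Set.mem_ofPred_eq, Set.mem_empty_iff_false, iff_false]
      intro hx
      exact h ((ind_mem_simple A).mem_toFinset.2 ⟨x, hx⟩)
    simp only [this, μ.empty, mul_zero]

theorem simple_eq_sum (f : lp (fun _ : α => ℝ) ∞) (hf : f ∈ simple α) :
    f = ∑ r ∈ hf.toFinset, r • ind {x | f x = r} := by
  classical
  ext x
  rw [lp.coeFn_sum, Finset.sum_apply, Finset.sum_eq_single (f x)]
  · simp [ind_apply]
  · intro r _ hr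
    have : x ∉ {x | f x = r} := fun h => hr (Eq.symm h)
    simp [ind_apply, this]
  · intro h
    exact absurd (hf.mem_toFinset.2 ⟨x, rfl⟩) h

theorem exists_simple_near (f : lp (fun _ : α => ℝ) ∞) {ε : ℝ} (hε : 0 < ε) :
    ∃ g ∈ simple α, ‖f - g‖ ≤ ε := by
  have hb : ∀ x, |f x| ≤ ‖f‖ := fun x => lp.norm_apply_le_norm ENNReal.top_ne_zero f x
  have hfin : (Set.range fun x => ε * (⌊f x / ε⌋ : ℝ)).Finite := by
    refine ((Set.finite_Icc ⌊-‖f‖ / ε⌋ ⌊‖f‖ / ε⌋).image fun k : ℤ => ε * (k : ℝ)).subset ?_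
    rintro _ ⟨x, rfl⟩
    refine ⟨⌊f x / ε⌋, ⟨?_, ?_⟩, rfl⟩
    · exact Int.floor_le_floor (div_le_div_of_nonneg_right (abs_le.1 (hb x)).1 hε.le)
    · exact Int.floor_le_floor (div_le_div_of_nonneg_right (abs_le.1 (hb x)).2 hε.le)
  have hmem : Memℓp (E := fun _ : α => ℝ) (fun x => ε * (⌊f x / ε⌋ : ℝ)) ∞ := by
    refine memℓp_infty ?_
    refine ((hfin.image norm).subset ?_).bddAbove
    rintro _ ⟨x, rfl⟩
    exact ⟨_, ⟨x, rfl⟩, rfl⟩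
  refine ⟨⟨_, hmem⟩, hfin, ?_⟩
  refine lp.norm_le_of_forall_le hε.le fun x => ?_
  change |f x - ε * (⌊f x / ε⌋ : ℝ)| ≤ ε
  have h1 := Int.floor_le (f x / ε)
  have h2 := (Int.lt_floor_add_one (f x / ε)).le
  rw [le_div_iff₀ hε] at h1
  rw [div_le_iff₀ hε] at h2
  rw [abs_le]
  constructor <;> nlinarith

/-- There is exactly one continuous linear functional on `ℓ_∞(α)` that takes the value `μ(A)` at
the indicator function of each set `A`. -/
theorem existsUnique_integral (μ : BA α) :
    ∃! L : StrongDual ℝ (lp (fun _ : α => ℝ) ∞), ∀ A : Set α, L (ind A) = μ A := by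
  obtain ⟨L, hL, -⟩ := exists_extension_norm_eq (simple α)
    (μ.simpleInt.mkContinuous ‖μ‖ fun f => μ.abs_simpleInt_le f)
  refine ⟨L, fun A => (hL ⟨ind A, ind_mem_simple A⟩).trans (μ.simpleInt_ind A), ?_⟩
  intro L' hL'
  have hd : Dense (simple α : Set (lp (fun _ : α => ℝ) ∞)) := by
    refine Metric.dense_iff.2 fun f ε hε => ?_
    obtain ⟨g, hg, hgf⟩ := exists_simple_near f (half_pos hε)
    refine ⟨g, ?_, hg⟩
    rw [Metric.mem_ball, dist_comm, dist_eq_norm]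
    linarith
  refine ContinuousLinearMap.ext fun f => congrFun
    (Continuous.ext_on hd L'.continuous L.continuous fun f hf => ?_) f
  rw [simple_eq_sum f hf]
  simp only [map_sum, map_smul, hL']
  refine Finset.sum_congr rfl fun r _ => ?_
  rw [show L (ind _) = μ _ from
    (hL ⟨ind _, ind_mem_simple _⟩).trans (μ.simpleInt_ind _)]

/-- The integral `f ↦ ∫ f dμ` of bounded functions against `μ ∈ ba(α)`: the continuous linear
functional on `ℓ_∞(α)` whose value at the indicator function of `A` is `μ(A)`. -/
def integral (μ : BA α) : StrongDual ℝ (lp (fun _ : α => ℝ) ∞) := μ.existsUnique_integral.choose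

theorem integral_ind (μ : BA α) (A : Set α) : μ.integral (ind A) = μ A :=
  μ.existsUnique_integral.choose_spec.1 A

end BA

/-! ### Optimal measures, cyclical monotonicity, slices -/

section

variable {M : Type*} [MetricSpace M]

/-- The adjoint `Φ* : ba → Lip₀(M)*`, `(Φ* μ)(f) = ∫ (f x - f y) / d(x, y) dμ(x, y)`. -/
def deLeeuwAdj (o : M) (μ : BA (Pairs M)) : StrongDual ℝ (Lip0 o) :=
  μ.integral.comp (deLeeuw o).toContinuousLinearMap

/-- `μ` is optimal: it is positive and `‖Φ* μ‖ = ‖μ‖`. -/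
def IsOptimal (o : M) (μ : BA (Pairs M)) : Prop :=
  (∀ A : Set (Pairs M), 0 ≤ μ A) ∧ ‖deLeeuwAdj o μ‖ = ‖μ‖

/-- `A` is `γ`-cyclically monotonic. A nonempty finite sequence is indexed by `Fin (n + 1)`, where
addition is cyclic: the successor `i + 1` of the last index is the first one. -/
def IsCyclMono (γ : ℝ) (A : Set (Pairs M)) : Prop :=
  ∀ (n : ℕ) (p : Fin (n + 1) → Pairs M), (∀ i, p i ∈ A) →
    0 ≤ ∑ i, min (dist (p i).1.1 (p (i + 1)).1.2 - γ * dist (p i).1.1 (p i).1.2)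
      (dist (p i).1.2 (p (i + 1)).1.2)

end

/-- The slice `S(F, a) = {x ∈ B_X : F x > 1 - a}` of the closed unit ball. -/
def slice {X : Type*} [NormedAddCommGroup X] [NormedSpace ℝ X] (F : StrongDual ℝ X) (a : ℝ) :
    Set X :=
  {x | x ∈ Metric.closedBall (0 : X) 1 ∧ 1 - a < F x}

/-- The local diameter 2 property: every slice of the closed unit ball has diameter 2. -/
def LD2P (X : Type*) [NormedAddCommGroup X] [NormedSpace ℝ X] : Prop :=
  ∀ F : StrongDual ℝ X, ‖F‖ = 1 → ∀ a : ℝ, 0 < a → Metric.diam (slice F a) = 2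

end LipSpace

end

/-! The theorem rests on two dictionaries. First, a set of pairs is `γ`-cyclically monotonic exactly
when some function in the unit ball has slopes at least `γ` on it: one direction is a telescoping
sum, the other (`IsCyclMono.exists_lipschitz`) builds a potential as an infimum of chain costs, as
in Rockafellar's theorem. Second, by `exists_optimal`, every norm-one functional on `Lip0 o` comes
from a positive measure of mass one. For such a measure, `deLeeuwAdj_le` and `le_deLeeuwAdj` say
that a function of the unit ball lies deep in the slice precisely when its slopes are close to 1 on
a set of measure close to 1.

Two functions in the slice at distance almost 2 have slopes near 1 and near -1 at some common pair
`(u, v)`. Hence both have large slopes on a common large set `A`, one of them also at `(u, v)` and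
the other at `(v, u)`. Reading this through the first dictionary gives both implications. -/

namespace LipSpace

open scoped ENNReal NNReal

/-! ### Cyclical monotonicity and potentials -/

section CyclMono

variable {M : Type*} [MetricSpace M]

/-- A set on which some `1`-Lipschitz function has slopes at least `γ` is `γ`-cyclically
monotonic. -/
theorem isCyclMono_of_lipschitz {γ : ℝ} {A : Set (Pairs M)} (f : M → ℝ)
    (hf : ∀ x y, f x - f y ≤ dist x y)
    (hA : ∀ p ∈ A, γ * dist p.1.1 p.1.2 ≤ f p.1.1 - f p.1.2) : IsCyclMono γ A := by
  intro n p hp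
  -- The sum telescopes around the cycle, and each minimum dominates the corresponding difference.
  have h0 : ∑ i, (f (p i).1.2 - f (p (i + 1)).1.2) = 0 := by
    rw [Finset.sum_sub_distrib, sub_eq_zero]
    exact (Equiv.sum_comp (Equiv.addRight (1 : Fin (n + 1))) fun i => f (p i).1.2).symm
  rw [← h0]
  refine Finset.sum_le_sum fun i _ => le_min ?_ (hf _ _)
  have h1 := hf (p i).1.1 (p (i + 1)).1.2
  have h2 := hA _ (hp i)
  linarith

/-- The cost of passing from the second point of the pair `p` to the point `z`, either directly
or through the first point of `p`. -/
def stepCost (γ : ℝ) (p : Pairs M) (z : M) : ℝ :=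
  min (dist p.1.1 z - γ * dist p.1.1 p.1.2) (dist p.1.2 z)

theorem stepCost_le_add (γ : ℝ) (p : Pairs M) (z w : M) :
    stepCost γ p z ≤ stepCost γ p w + dist z w := by
  have h1 := dist_triangle_right p.1.1 z w
  have h2 := dist_triangle_right p.1.2 z w
  have h3 := dist_triangle p.1.1 w z
  have h4 := dist_triangle p.1.2 w z
  rw [dist_comm w z] at h3 h4
  unfold stepCost
  rw [← min_add_add_right]
  exact min_le_min (by linarith) (by linarith)

/-- The cost of passing along the chain of pairs `p` to the point `z`. -/
def chainCost (γ : ℝ) {n : ℕ} (p : Fin (n + 1) → Pairs M) (z : M) : ℝ :=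
  ∑ i : Fin n, stepCost γ (p i.castSucc) (p i.succ).1.2 + stepCost γ (p (Fin.last n)) z

/-- The costs of all chains in `A` that start at `q` and end at the point `z`. -/
def chainCosts (γ : ℝ) (A : Set (Pairs M)) (q : Pairs M) (z : M) : Set ℝ :=
  {t | ∃ (n : ℕ) (p : Fin (n + 1) → Pairs M), (∀ i, p i ∈ A) ∧ p 0 = q ∧ t = chainCost γ p z}

/-- A chain closed up at the second point of its first pair has as its cost the cyclic sum: the
successor of the last index is 0. -/
theorem IsCyclMono.chainCost_nonneg {γ : ℝ} {A : Set (Pairs M)} (h : IsCyclMono γ A) {n : ℕ}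
    (p : Fin (n + 1) → Pairs M) (hp : ∀ i, p i ∈ A) : 0 ≤ chainCost γ p (p 0).1.2 := by
  have := h n p hp
  rw [Fin.sum_univ_castSucc] at this
  simpa [chainCost, stepCost, Fin.last_add_one] using this

theorem chainCost_snoc (γ : ℝ) {n : ℕ} (p : Fin (n + 1) → Pairs M) (q : Pairs M) (z : M) :
    chainCost γ (Fin.snoc p q : Fin (n + 1 + 1) → Pairs M) z =
      chainCost γ p q.1.2 + stepCost γ q z := by
  unfold chainCost
  rw [Fin.sum_univ_castSucc]
  simp only [Fin.snoc_castSucc, Fin.succ_last, Fin.snoc_last, ← Fin.castSucc_succ]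

theorem chainCost_le_add (γ : ℝ) {n : ℕ} (p : Fin (n + 1) → Pairs M) (z w : M) :
    chainCost γ p z ≤ chainCost γ p w + dist z w := by
  have := stepCost_le_add γ (p (Fin.last n)) z w
  unfold chainCost
  linarith

/-- On a `γ`-cyclically monotonic set, some `1`-Lipschitz function has slopes at least `γ`. -/
theorem IsCyclMono.exists_lipschitz {γ : ℝ} {A : Set (Pairs M)} (h : IsCyclMono γ A) :
    ∃ f : M → ℝ, (∀ x y, f x - f y ≤ dist x y) ∧
      ∀ p ∈ A, γ * dist p.1.1 p.1.2 ≤ f p.1.1 - f p.1.2 := by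
  rcases A.eq_empty_or_nonempty with rfl | ⟨q, hq⟩
  · exact ⟨fun _ => 0, fun x y => by simp, by simp⟩
  have hne : ∀ z, (chainCosts γ A q z).Nonempty := fun z =>
    ⟨_, 0, fun _ => q, fun _ => hq, rfl, rfl⟩
  have hbdd : ∀ z, BddBelow (chainCosts γ A q z) := by
    intro z
    -- Returning from `z` to the start of the chain closes the cycle and costs at most `dist q.1.2
    -- z`.
    refine ⟨-dist q.1.2 z, ?_⟩
    rintro _ ⟨n, p, hp, h0, rfl⟩
    have h1 := h.chainCost_nonneg p hp
    have h2 := chainCost_le_add γ p q.1.2 z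
    rw [h0] at h1
    linarith
  -- The least cost of reaching `z` is 1-Lipschitz because each chain cost is. The sign turns a drop
  -- in cost from `r.1.2` to `r.1.1` into a positive slope.
  refine ⟨fun z => -sInf (chainCosts γ A q z), fun x y => ?_, fun r hr => ?_⟩
  · have : sInf (chainCosts γ A q y) - dist x y ≤ sInf (chainCosts γ A q x) := by
      refine le_csInf (hne x) ?_
      rintro _ ⟨n, p, hp, h0, rfl⟩
      have h1 := csInf_le (hbdd y) ⟨n, p, hp, h0, rfl⟩
      have h2 := chainCost_le_add γ p y x
      rw [dist_comm y x] at h2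
      linarith
    linarith
  · have : sInf (chainCosts γ A q r.1.1) + γ * dist r.1.1 r.1.2 ≤
        sInf (chainCosts γ A q r.1.2) := by
      refine le_csInf (hne _) ?_
      rintro _ ⟨n, p, hp, h0, rfl⟩
      -- Any chain reaching `r.1.2` can be prolonged by `r` itself to reach `r.1.1`, at the extra
      -- cost `-γ * dist r.1.1 r.1.2` or less.
      have h1 : sInf (chainCosts γ A q r.1.1) ≤
          chainCost γ (Fin.snoc p r : Fin (n + 1 + 1) → Pairs M) r.1.1 := by
        refine csInf_le (hbdd _) ⟨n + 1, Fin.snoc p r, ?_, ?_, rfl⟩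
        · refine Fin.lastCases ?_ fun i => ?_
          · simpa using hr
          · simpa using hp i
        · rw [← Fin.castSucc_zero, Fin.snoc_castSucc, h0]
      have h2 : stepCost γ r r.1.1 ≤ dist r.1.1 r.1.1 - γ * dist r.1.1 r.1.2 := min_le_left _ _
      rw [chainCost_snoc] at h1
      rw [dist_self] at h2
      linarith
    linarith

end CyclMono

/-! ### Slopes and the unit ball of the Lipschitz space -/

namespace Lip0

variable {M : Type*} [MetricSpace M] {o : M}

theorem slope_le_norm (f : Lip0 o) (p : Pairs M) : slope f p ≤ ‖f‖ := by
  rw [← norm_slopeLin]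
  exact (le_abs_self _).trans (lp.norm_apply_le_norm ENNReal.top_ne_zero (slopeLin o f) p)

theorem slope_swap (f : M → ℝ) (p : Pairs M) :
    slope f ⟨p.1.swap, p.2.symm⟩ = -slope f p := by
  simp only [slope, Prod.fst_swap, Prod.snd_swap, dist_comm p.1.2 p.1.1]
  ring

/-- Swapping a pair negates the slope, so a one-sided bound is enough. -/
theorem norm_le_of_slope_le (f : Lip0 o) {c : ℝ} (hc : 0 ≤ c) (h : ∀ p, slope f p ≤ c) :
    ‖f‖ ≤ c := by
  rw [norm_def]
  refine Real.iSup_le (fun p => ?_) hc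
  rw [← norm_slope, Real.norm_eq_abs, abs_le]
  have h1 := h ⟨p.1.swap, p.2.symm⟩
  rw [slope_swap] at h1
  exact ⟨by linarith, h p⟩

theorem sub_le_dist {f : Lip0 o} (hf : ‖f‖ ≤ 1) (x y : M) : f x - f y ≤ dist x y := by
  by_cases hxy : x = y
  · simp [hxy]
  · have h : (f x - f y) / dist x y ≤ 1 := (slope_le_norm f ⟨(x, y), hxy⟩).trans hf
    rwa [div_le_one (dist_pos.2 hxy)] at h

/-- A `1`-Lipschitz function, translated so as to vanish at the base point, is in the unit ball. -/
theorem exists_norm_le_one (o : M) {f : M → ℝ} (hf : ∀ x y, f x - f y ≤ dist x y) :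
    ∃ g : Lip0 o, ‖g‖ ≤ 1 ∧ ∀ p, slope g p = slope f p := by
  have hl : LipschitzWith 1 fun x => f x - f o := by
    refine LipschitzWith.of_le_add fun x y => ?_
    have := hf x y
    linarith
  let g : Lip0 o := ⟨fun x => f x - f o, ⟨1, hl⟩, sub_self _⟩
  have hg : ∀ p, slope g p = slope f p := fun p => by
    change (f p.1.1 - f o - (f p.1.2 - f o)) / _ = _
    rw [sub_sub_sub_cancel_right, slope]
  refine ⟨g, norm_le_of_slope_le g zero_le_one fun p => ?_, hg⟩
  rw [hg, slope, div_le_one (dist_pos.2 p.2)]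
  exact hf _ _

end Lip0

/-! ### Positive finitely additive measures and their integrals -/

namespace BA

variable {α : Type*} {μ : BA α}

theorem mono_of_nonneg (hμ : ∀ A, 0 ≤ μ A) {A B : Set α} (h : A ⊆ B) : μ A ≤ μ B := by
  have h1 := μ.union' A (B \ A) Set.disjoint_sdiff_right
  rw [Set.union_sdiff_cancel h] at h1
  have := hμ (B \ A)
  linarith

theorem add_compl (μ : BA α) (A : Set α) : μ A + μ Aᶜ = μ Set.univ := by
  rw [← μ.union' A Aᶜ disjoint_compl_right, Set.union_compl_self]

theorem norm_of_nonneg (hμ : ∀ A, 0 ≤ μ A) : ‖μ‖ = μ Set.univ := by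
  refine le_antisymm (csSup_le ⟨0, ∅, by simp, by simp⟩ ?_) ?_
  · rintro _ ⟨P, hP, rfl⟩
    rw [Finset.sum_congr rfl fun A _ => abs_of_nonneg (hμ A), μ.sum_eq P hP]
    exact mono_of_nonneg hμ (Set.subset_univ _)
  · have := μ.sum_le_norm {Set.univ} (by simp)
    rw [Finset.sum_singleton] at this
    exact (le_abs_self _).trans this

theorem integral_nonneg (hμ : ∀ A, 0 ≤ μ A) (f : lp (fun _ : α => ℝ) ∞) (hf : ∀ x, 0 ≤ f x) :
    0 ≤ μ.integral f := by
  refine le_of_forall_pos_le_add fun δ hδ => ?_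
  -- Replacing `f` by a simple function within `δ / K`, raised by `δ / K` to be nonnegative, changes
  -- the integral by at most `(δ / K) * (μ Set.univ + ‖μ.integral‖)`, which is less than `δ`.
  have hK : 0 < μ Set.univ + ‖μ.integral‖ + 1 := by
    have := hμ Set.univ
    positivity
  set K := μ Set.univ + ‖μ.integral‖ + 1
  have hε : 0 < δ / K := div_pos hδ hK
  obtain ⟨g, hg, hfg⟩ := exists_simple_near f hε
  have hg' : g + (δ / K) • ind Set.univ ∈ simple α :=
    add_mem hg (Submodule.smul_mem _ _ (ind_mem_simple _))
  have hpos : 0 ≤ μ.integral (g + (δ / K) • ind Set.univ) := by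
    rw [simple_eq_sum _ hg', map_sum]
    refine Finset.sum_nonneg fun r hr => ?_
    rw [map_smul, integral_ind, smul_eq_mul]
    refine mul_nonneg ?_ (hμ _)
    obtain ⟨x, rfl⟩ := hg'.mem_toFinset.1 hr
    have h1 : |f x - g x| ≤ δ / K :=
      (lp.norm_apply_le_norm ENNReal.top_ne_zero (f - g) x).trans hfg
    have h2 := (abs_le.1 h1).2
    have h3 := hf x
    have h4 : (g + (δ / K) • ind Set.univ : lp (fun _ : α => ℝ) ∞) x = g x + δ / K := by
      change g x + δ / K * ind Set.univ x = _
      simp [ind_apply]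
    rw [h4]
    linarith
  rw [map_add, map_smul, integral_ind, smul_eq_mul] at hpos
  have h5 : |μ.integral (f - g)| ≤ ‖μ.integral‖ * (δ / K) :=
    (μ.integral.le_opNorm _).trans (mul_le_mul_of_nonneg_left hfg (norm_nonneg _))
  rw [map_sub] at h5
  have h6 := (abs_le.1 h5).1
  have h7 : K * (δ / K) = δ := mul_div_cancel₀ δ hK.ne'
  have h8 : (K - 1) * (δ / K) = μ Set.univ * (δ / K) + ‖μ.integral‖ * (δ / K) := by
    rw [← add_mul, add_sub_cancel_right]
  have h9 : (K - 1) * (δ / K) = δ - δ / K := by rw [sub_mul, h7, one_mul]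
  linarith

theorem integral_mono (hμ : ∀ A, 0 ≤ μ A) {f g : lp (fun _ : α => ℝ) ∞} (h : ∀ x, f x ≤ g x) :
    μ.integral f ≤ μ.integral g := by
  rw [← sub_nonneg, ← map_sub]
  exact integral_nonneg hμ _ fun x => sub_nonneg.2 (h x)

/-- The finitely additive measure `A ↦ L(1_A)` of a functional `L` on `ℓ_∞(α)`. -/
noncomputable def ofDual (L : StrongDual ℝ (lp (fun _ : α => ℝ) ∞)) : BA α where
  toFun A := L (ind A)
  union' A B hAB := by
    rw [← map_add]
    congr 1
    ext x
    change ind (A ∪ B) x = ind A x + ind B x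
    simp only [ind_apply, Set.indicator_union_of_disjoint hAB]
  bounded' := by
    refine ⟨‖L‖ * 1, fun A => (L.le_opNorm _).trans ?_⟩
    refine mul_le_mul_of_nonneg_left (lp.norm_le_of_forall_le zero_le_one fun x => ?_)
      (norm_nonneg _)
    by_cases hx : x ∈ A <;> simp [ind_apply, hx]

theorem integral_ofDual (L : StrongDual ℝ (lp (fun _ : α => ℝ) ∞)) : (ofDual L).integral = L :=
  (ofDual L).existsUnique_integral.unique (integral_ind _) fun _ => rfl

end BA

/-! ### Representation of functionals and the two implications -/

section

variable {M : Type*} [MetricSpace M] {o : M}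

/-- Integrate the pointwise bound of the slope by `γ` where it is below `γ`, and by 1 elsewhere. A
value near 1 thus forces the set of small slopes to have small measure. -/
theorem deLeeuwAdj_le {μ : BA (Pairs M)} (hμ : ∀ A, 0 ≤ μ A) (h1 : μ Set.univ = 1) {f : Lip0 o}
    (hf : ‖f‖ ≤ 1) (γ : ℝ) :
    deLeeuwAdj o μ f ≤ 1 - (1 - γ) * μ {p | slope f p < γ} := by
  have h : μ.integral (deLeeuw o f) ≤
      μ.integral (BA.ind Set.univ - (1 - γ) • BA.ind {p | slope f p < γ}) := by
    refine BA.integral_mono hμ fun p => ?_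
    have hp := (Lip0.slope_le_norm f p).trans hf
    change slope f p ≤ BA.ind Set.univ p - (1 - γ) * BA.ind {p | slope f p < γ} p
    by_cases hpγ : slope f p < γ
    · simp only [BA.ind_apply, Set.mem_univ, Set.indicator_of_mem, Set.mem_ofPred_eq, hpγ]
      linarith
    · simp [BA.ind_apply, hpγ, hp]
  rwa [map_sub, map_smul, BA.integral_ind, BA.integral_ind, h1] at h

/-- Integrate the pointwise lower bound `γ` on `A` and -1 off `A`. -/
theorem le_deLeeuwAdj {μ : BA (Pairs M)} (hμ : ∀ A, 0 ≤ μ A) (h1 : μ Set.univ = 1) {f : Lip0 o}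
    (hf : ‖f‖ ≤ 1) {γ : ℝ} {A : Set (Pairs M)} (hA : ∀ p ∈ A, γ ≤ slope f p) :
    (1 + γ) * μ A - 1 ≤ deLeeuwAdj o μ f := by
  have h : μ.integral ((1 + γ) • BA.ind A - BA.ind Set.univ) ≤ μ.integral (deLeeuw o f) := by
    refine BA.integral_mono hμ fun p => ?_
    have hp := (Lip0.slope_le_norm (-f) p).trans ((norm_neg f).trans_le hf)
    have hneg : slope (-f : Lip0 o) p = -slope f p :=
      congrFun (congrArg Subtype.val (map_neg (Lip0.slopeLin o) f)) p
    rw [hneg] at hp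
    change (1 + γ) * BA.ind A p - BA.ind Set.univ p ≤ slope f p
    by_cases hpA : p ∈ A
    · have := hA p hpA
      simp only [BA.ind_apply, Set.mem_univ, Set.indicator_of_mem, hpA]
      linarith
    · simp only [BA.ind_apply, Set.mem_univ, Set.indicator_of_mem, hpA, not_false_eq_true,
        Set.indicator_of_notMem]
      linarith
  rwa [map_sub, map_smul, BA.integral_ind, BA.integral_ind, h1] at h

theorem bddAbove_range_lp {α : Type*} (φ : lp (fun _ : α => ℝ) ∞) : BddAbove (Set.range φ) :=
  ⟨‖φ‖, by
    rintro _ ⟨x, rfl⟩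
    exact (le_abs_self _).trans (lp.norm_apply_le_norm ENNReal.top_ne_zero φ x)⟩

/-- Every functional of norm one on `Lip₀(M)` is represented by an optimal measure of norm one. -/
theorem exists_optimal (F : StrongDual ℝ (Lip0 o)) (hF : ‖F‖ = 1) :
    ∃ μ : BA (Pairs M), IsOptimal o μ ∧ ‖μ‖ = 1 ∧ deLeeuwAdj o μ = F := by
  -- Without pairs the space is trivial and carries no functional of norm one.
  have hne : Nonempty (Pairs M) := by
    by_contra hemp
    rw [not_nonempty_iff] at hemp
    have : ‖F‖ ≤ 0 := F.opNorm_le_bound le_rfl fun f => by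
      have : f = 0 := norm_le_zero_iff.1
        (Lip0.norm_le_of_slope_le f le_rfl fun p => hemp.elim p)
      simp [this]
    linarith
  let e := LinearEquiv.ofInjective (Lip0.slopeLin o) Lip0.slopeLin_injective
  let f₀ : lp (fun _ : Pairs M => ℝ) ∞ →ₗ.[ℝ] ℝ :=
    ⟨LinearMap.range (Lip0.slopeLin o), F.toLinearMap ∘ₗ e.symm.toLinearMap⟩
  have hf₀ : ∀ g : Lip0 o, f₀ (e g) = F g := fun g => by
    change F (e.symm (e g)) = F g
    rw [e.symm_apply_apply]
  -- Hahn–Banach is applied with the supremum, not the norm, as the sublinear bound: this makes the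
  -- extension positive. On slope functions the bound still dominates the norm, since slopes at
  -- swapped pairs are opposite.
  obtain ⟨L, hL, hLN⟩ := exists_extension_of_le_sublinear f₀ (fun φ => ⨆ p, φ p)
    (fun c hc φ => by
      rw [Real.mul_iSup_of_nonneg hc.le]
      rfl)
    (fun φ ψ => ciSup_le fun p =>
      add_le_add (le_ciSup (bddAbove_range_lp φ) p) (le_ciSup (bddAbove_range_lp ψ) p))
    (fun φ => by
      obtain ⟨g, rfl⟩ := e.surjective φ
      rw [hf₀]
      have h1 : F g ≤ ‖g‖ := by
        have := F.le_opNorm g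
        rw [hF, one_mul] at this
        exact (le_abs_self _).trans this
      refine h1.trans ?_
      have hle : ∀ p, slope g p ≤ ⨆ p, slope g p := fun p =>
        le_ciSup (bddAbove_range_lp (Lip0.slopeLin o g)) p
      refine Lip0.norm_le_of_slope_le g ?_ hle
      change 0 ≤ ⨆ p, slope g p
      obtain ⟨p⟩ := hne
      have h2 := hle p
      have h3 := hle ⟨p.1.swap, p.2.symm⟩
      rw [Lip0.slope_swap] at h3
      linarith)
  have hLle : ∀ φ, L φ ≤ ‖φ‖ := fun φ => (hLN φ).trans <| ciSup_le fun p =>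
    (le_abs_self _).trans (lp.norm_apply_le_norm ENNReal.top_ne_zero φ p)
  let L' : StrongDual ℝ (lp (fun _ : Pairs M => ℝ) ∞) := L.mkContinuous 1 fun φ => by
    rw [one_mul, Real.norm_eq_abs, abs_le]
    have := hLle (-φ)
    rw [map_neg, norm_neg] at this
    exact ⟨by linarith, hLle φ⟩
  have hadj : deLeeuwAdj o (BA.ofDual L') = F := by
    ext g
    change (BA.ofDual L').integral (deLeeuw o g) = F g
    rw [BA.integral_ofDual, ← hf₀ g]
    exact hL (e g)
  have hpos : ∀ A, 0 ≤ BA.ofDual L' A := fun A => by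
    have h1 : L (-BA.ind A) ≤ 0 := (hLN _).trans <| ciSup_le fun p => by
      change -BA.ind A p ≤ 0
      by_cases hp : p ∈ A <;> simp [BA.ind_apply, hp]
    rw [map_neg] at h1
    change 0 ≤ L (BA.ind A)
    linarith
  have huniv : BA.ofDual L' Set.univ = 1 := by
    change L (BA.ind Set.univ) = 1
    have h1 : L (BA.ind Set.univ) ≤ 1 := (hLN _).trans <| ciSup_le fun p => by
      simp [BA.ind_apply]
    have h2 : L (-BA.ind Set.univ) ≤ -1 := (hLN _).trans <| ciSup_le fun p => by
      change -BA.ind Set.univ p ≤ -1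
      simp [BA.ind_apply]
    rw [map_neg] at h2
    linarith
  have hnorm : ‖BA.ofDual L'‖ = 1 := (BA.norm_of_nonneg hpos).trans huniv
  exact ⟨BA.ofDual L', ⟨hpos, by rw [hadj, hF, hnorm]⟩, hnorm, hadj⟩

theorem slice_subset_closedBall {X : Type*} [NormedAddCommGroup X] [NormedSpace ℝ X]
    (F : StrongDual ℝ X) (a : ℝ) : slice F a ⊆ Metric.closedBall 0 1 := fun _ h => h.1

theorem IsCyclMono.exists_lip0 (o : M) {γ : ℝ} {A : Set (Pairs M)} (h : IsCyclMono γ A) :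
    ∃ f : Lip0 o, ‖f‖ ≤ 1 ∧ ∀ p ∈ A, γ ≤ slope f p := by
  obtain ⟨f, hf, hA⟩ := h.exists_lipschitz
  obtain ⟨g, hg, hs⟩ := Lip0.exists_norm_le_one o hf
  refine ⟨g, hg, fun p hp => ?_⟩
  rw [hs, slope, le_div_iff₀ (dist_pos.2 p.2)]
  exact hA p hp

theorem isCyclMono_of_slope {γ : ℝ} {A : Set (Pairs M)} {f : Lip0 o} (hf : ‖f‖ ≤ 1)
    (hA : ∀ p ∈ A, γ ≤ slope f p) : IsCyclMono γ A := by
  refine isCyclMono_of_lipschitz f (Lip0.sub_le_dist hf) fun p hp => ?_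
  rw [← le_div_iff₀ (dist_pos.2 p.2)]
  exact hA p hp

theorem slope_sub (f g : Lip0 o) (p : Pairs M) :
    slope (f - g : Lip0 o) p = slope f p - slope g p :=
  congrFun (congrArg Subtype.val (map_sub (Lip0.slopeLin o) f g)) p

theorem exists_isCyclMono_of_LD2P (h : LD2P (Lip0 o)) {μ : BA (Pairs M)} (hμ : IsOptimal o μ)
    (hμ1 : ‖μ‖ = 1) {γ : ℝ} (hγ0 : 0 < γ) (hγ1 : γ < 1) :
    ∃ (A : Set (Pairs M)) (u v : M) (huv : u ≠ v),
      γ ≤ μ A ∧ IsCyclMono γ (A ∪ {⟨(u, v), huv⟩}) ∧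
        IsCyclMono γ (A ∪ {⟨(v, u), huv.symm⟩}) := by
  have huniv : μ Set.univ = 1 := (BA.norm_of_nonneg hμ.1).symm.trans hμ1
  have hγ : 0 < 1 - γ := sub_pos.2 hγ1
  -- With this width, each function of the slice has slopes below `γ` only on a set of measure at
  -- most `(1 - γ) / 2`, so two functions together lose at most `1 - γ`.
  set a : ℝ := (1 - γ) * ((1 - γ) / 2) with ha
  have ha0 : 0 < a := by positivity
  have ha1 : a ≤ 1 - γ := mul_le_of_le_one_right hγ.le (by linarith)
  have hdiam := h (deLeeuwAdj o μ) (hμ.2.trans hμ1) a ha0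
  obtain ⟨f, hf, g, hg, hfg⟩ : ∃ f ∈ slice (deLeeuwAdj o μ) a,
      ∃ g ∈ slice (deLeeuwAdj o μ) a, 2 - a < dist f g := by
    by_contra! hcon
    have := Metric.diam_le_of_forall_dist_le (by linarith) hcon
    linarith
  have hf1 : ‖f‖ ≤ 1 := mem_closedBall_zero_iff.1 hf.1
  have hg1 : ‖g‖ ≤ 1 := mem_closedBall_zero_iff.1 hg.1
  obtain ⟨q, hq⟩ : ∃ q, 2 - a < slope (f - g : Lip0 o) q := by
    by_contra! hcon
    have := Lip0.norm_le_of_slope_le _ (by linarith) hcon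
    rw [dist_eq_norm] at hfg
    linarith
  rw [slope_sub] at hq
  have hsmall : ∀ k ∈ slice (deLeeuwAdj o μ) a, μ {p | slope k p < γ} ≤ (1 - γ) / 2 := by
    intro k hk
    have h1 := deLeeuwAdj_le hμ.1 huniv (mem_closedBall_zero_iff.1 hk.1) γ
    have h2 := hk.2
    refine le_of_mul_le_mul_left (a := 1 - γ) ?_ hγ
    linarith
  -- As both slopes are at most 1 in absolute value, `hq` forces the slope of `f` at `q`, and that
  -- of `g` at the swapped pair, above `1 - a ≥ γ`.
  have hswap := Lip0.slope_swap g q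
  have hqf := (Lip0.slope_le_norm f q).trans hf1
  have hqg := (Lip0.slope_le_norm g ⟨q.1.swap, q.2.symm⟩).trans hg1
  refine ⟨{p | γ ≤ slope f p ∧ γ ≤ slope g p}, q.1.1, q.1.2, q.2, ?_, ?_, ?_⟩
  · have h1 := BA.add_compl μ {p | γ ≤ slope f p ∧ γ ≤ slope g p}
    have h2 : {p | γ ≤ slope f p ∧ γ ≤ slope g p}ᶜ =
        {p | slope f p < γ} ∪ ({p | slope g p < γ} \ {p | slope f p < γ}) := by
      ext p
      simp only [Set.mem_compl_iff, Set.mem_ofPred_eq, Set.union_sdiff_self, Set.mem_union,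
        not_and_or, not_le]
    rw [h2, μ.union' _ _ Set.disjoint_sdiff_right] at h1
    have h3 := BA.mono_of_nonneg hμ.1
      (Set.sdiff_subset : {p | slope g p < γ} \ {p | slope f p < γ} ⊆ {p | slope g p < γ})
    have h4 := hsmall f hf
    have h5 := hsmall g hg
    linarith
  · refine isCyclMono_of_slope hf1 ?_
    rintro p (hp | rfl)
    · exact hp.1
    · change γ ≤ slope f q
      linarith
  · refine isCyclMono_of_slope hg1 ?_
    rintro p (hp | rfl)
    · exact hp.2
    · change γ ≤ slope g ⟨q.1.swap, q.2.symm⟩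
      linarith

theorem LD2P_of_exists_isCyclMono
    (h : ∀ μ : BA (Pairs M), IsOptimal o μ → ‖μ‖ = 1 → ∀ γ : ℝ, 0 < γ → γ < 1 →
      ∃ (A : Set (Pairs M)) (u v : M) (huv : u ≠ v),
        γ ≤ μ A ∧ IsCyclMono γ (A ∪ {⟨(u, v), huv⟩}) ∧
          IsCyclMono γ (A ∪ {⟨(v, u), huv.symm⟩})) : LD2P (Lip0 o) := by
  intro F hF a ha
  obtain ⟨μ, hμ, hμ1, rfl⟩ := exists_optimal F hF
  have huniv : μ Set.univ = 1 := (BA.norm_of_nonneg hμ.1).symm.trans hμ1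
  have hbdd : Bornology.IsBounded (slice (deLeeuwAdj o μ) a) :=
    Metric.isBounded_closedBall.subset (slice_subset_closedBall _ _)
  refine le_antisymm ?_ ?_
  · refine (Metric.diam_mono (slice_subset_closedBall _ _) Metric.isBounded_closedBall).trans ?_
    simpa using Metric.diam_closedBall (x := (0 : Lip0 o)) zero_le_one
  · refine le_of_forall_pos_sub_le fun ε hε => ?_
    -- Take `γ = 1 - δ`. The bound `a / 4` puts both functions in the slice, because `(2 - δ) * (1 -
    -- δ) - 1 > 1 - 4 * δ`; `ε / 2` gives distance at least `2 - 2 * δ ≥ 2 - ε`; and `1 / 2` keeps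
    -- `γ` positive.
    set δ : ℝ := min (min (a / 4) (ε / 2)) (1 / 2) with hδ
    have hδ0 : 0 < δ := by positivity
    have hδa : δ ≤ a / 4 := (min_le_left _ _).trans (min_le_left _ _)
    have hδε : δ ≤ ε / 2 := (min_le_left _ _).trans (min_le_right _ _)
    have hδ2 : δ ≤ 1 / 2 := min_le_right _ _
    obtain ⟨A, u, v, huv, hA, hf, hg⟩ := h μ hμ hμ1 (1 - δ) (by linarith) (by linarith)
    have hmem : ∀ k : Lip0 o, ‖k‖ ≤ 1 → (∀ p ∈ A, 1 - δ ≤ slope k p) →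
        k ∈ slice (deLeeuwAdj o μ) a := by
      intro k hk hkA
      refine ⟨mem_closedBall_zero_iff.2 hk, ?_⟩
      have h1 := le_deLeeuwAdj hμ.1 huniv hk hkA
      have h2 : (1 + (1 - δ)) * (1 - δ) ≤ (1 + (1 - δ)) * μ A :=
        mul_le_mul_of_nonneg_left hA (by linarith)
      nlinarith
    obtain ⟨f, hf1, hfA⟩ := hf.exists_lip0 o
    obtain ⟨g, hg1, hgA⟩ := hg.exists_lip0 o
    have h1 := hfA ⟨(u, v), huv⟩ (Or.inr rfl)
    have h2 := hgA ⟨(v, u), huv.symm⟩ (Or.inr rfl)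
    have h3 : slope g ⟨(v, u), huv.symm⟩ = -slope g ⟨(u, v), huv⟩ :=
      Lip0.slope_swap g ⟨(u, v), huv⟩
    have h4 := Lip0.slope_le_norm (f - g) ⟨(u, v), huv⟩
    rw [slope_sub] at h4
    have h5 := Metric.dist_le_diam_of_mem hbdd (hmem f hf1 fun p hp => hfA p (Or.inl hp))
      (hmem g hg1 fun p hp => hgA p (Or.inl hp))
    rw [dist_eq_norm] at h5
    linarith

end

end LipSpace

open LipSpace in
theorem proposition3p2 {M : Type*} [MetricSpace M] (o : M) :
    LD2P (Lip0 o) ↔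
      ∀ μ : BA (Pairs M), IsOptimal o μ → ‖μ‖ = 1 → ∀ γ : ℝ, 0 < γ → γ < 1 →
        ∃ (A : Set (Pairs M)) (u v : M) (huv : u ≠ v),
          γ ≤ μ A ∧ IsCyclMono γ (A ∪ {⟨(u, v), huv⟩}) ∧
            IsCyclMono γ (A ∪ {⟨(v, u), huv.symm⟩}) :=
  ⟨fun h _ hμ hμ1 _ hγ0 hγ1 => exists_isCyclMono_of_LD2P h hμ hμ1 hγ0 hγ1,
    LD2P_of_exists_isCyclMono⟩
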